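/- Let $n\ge 0$ be an integer and let $f(x)=\sum_{j=0}^n\binom nj c_jx^j\in\mathbb Q[x]$ be an irreducible polynomial of degree $n$ over $\mathbb Q$. For a prime $p$ let $\operatorname{ord}_p$ denote the $p$-adic valuation on $\mathbb Q$, normalized by $\operatorname{ord}_p(p)=1$, with $\operatorname{ord}_p(0)=\infty$. Suppose there exists a prime $p$ such that (i) $n/2<p<n-2$; (ii) $\operatorname{ord}_p(c_j)\ge 0$ for $0\le j\le n$; (iii) $\operatorname{ord}_p(c_j)=1$ for $0\le j\le n-p$; (iv) $\operatorname{ord}_p(c_p)=0$. Then the Galois group of $f$ over $\mathbb Q$, viewed as a group of permutations of the $n$ complex roots of $f$, contains the alternating group $A_n$, i.e. every even permutation of the roots. -/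

import Mathlib

open Polynomial

/-- The `p`-adic valuation of a rational number, normalized by `ord_p(p) = 1`, with the usual
convention `ord_p(0) = ∞`. -/
noncomputable def ordAt (p : ℕ) (q : ℚ) : WithTop ℤ :=
  if q = 0 then ⊤ else ((padicValRat p q : ℤ) : WithTop ℤ)

/-- The Galois group of `f` over `ℚ`, viewed as a group of permutations of the set of complex
roots of `f`, contains every even permutation of the roots. -/
def GaloisGroupContainsAlternating (f : ℚ[X]) : Prop :=
  letI : DecidableEq (f.rootSet ℂ) := Classical.decEq _
  haveI : Fact ((f.map (algebraMap ℚ ℂ)).Splits) := Polynomial.Gal.splits_ℚ_ℂ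
  alternatingGroup (f.rootSet ℂ) ≤ (Polynomial.Gal.galActionHom f ℂ).range

/-! Since `p ∣ n.choose j` for `n - p < j < p`, the `p`-adic Newton polygon of `f` begins with an
edge from `(0, 1)` to `(p, 0)`. Some root in the splitting field thus has valuation `1 / p`, so `p`
divides the ramification index at `p`, hence the order of the Galois group
(`Polynomial.IsSplittingField.prime_dvd_card_of_ordAt`). By Cauchy there is an element of order `p`,
a `p`-cycle because `n < 2 * p`. The group is transitive by irreducibility, and the cycle fixes at
least three points, so Jordan's theorem applies
(`Equiv.Perm.alternatingGroup_le_of_isPretransitive_of_orderOf_prime`). Its proof extracts a 3-cycle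
from a commutator in the normalizer of the `p`-cycle. -/

/-! ### Jordan's theorem on permutation groups containing a `p`-cycle. -/

open MulAction Equiv Equiv.Perm in
/-- Two elements of prime order `p` of a permutation group of degree less than `2 * p` generate
conjugate subgroups. -/
theorem Equiv.Perm.exists_conj_mem_zpowers_of_card_lt {α : Type*} [Fintype α] [DecidableEq α]
    {p : ℕ} [Fact p.Prime] (hα : Fintype.card α < 2 * p) {H : Subgroup (Perm α)} {a b : Perm α}
    (ha : a ∈ H) (hb : b ∈ H) (hao : orderOf a = p) (hbo : orderOf b = p) :
    ∃ h ∈ H, h * b * h⁻¹ ∈ Subgroup.zpowers a := by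
  have hp : p.Prime := Fact.out
  have hle : p ≤ Fintype.card α := by
    have h : p ∣ (Fintype.card α).factorial := by
      rw [← Fintype.card_perm, ← hao]; exact orderOf_dvd_card
    exact hp.dvd_factorial.1 h
  -- As `p ≤ card α < 2 * p`, `p` divides `(card α)!` exactly once, so subgroups of order `p` are
  -- Sylow, hence conjugate.
  have hfac : (Nat.card H).factorization p = 1 := by
    apply le_antisymm
    · calc (Nat.card H).factorization p ≤ (Nat.card (Perm α)).factorization p :=
            (Nat.factorization_le_iff_dvd Nat.card_pos.ne' Nat.card_pos.ne').2
              (Subgroup.card_subgroup_dvd_card H) p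
        _ = 1 := by
            rw [Nat.card_eq_fintype_card, Fintype.card_perm,
              Nat.factorization_def _ hp]
            obtain ⟨k, hk⟩ := Nat.exists_eq_add_of_le hle
            rw [hk, show p + k = p * 1 + k by ring,
              padicValNat_factorial_mul_add 1 (by omega), padicValNat_factorial_mul]
            simp
    · rw [← hp.dvd_iff_one_le_factorization Nat.card_pos.ne', ← hao, ← Subgroup.orderOf_mk a ha]
      exact orderOf_dvd_natCard _
  have key (c : H) (hc : orderOf c = p) :
      Nat.card (Subgroup.zpowers c) = p ^ (Nat.card H).factorization p := by
    rw [Nat.card_zpowers, hc, hfac, pow_one]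
  let A : Sylow p H := Sylow.ofCard (Subgroup.zpowers ⟨a, ha⟩) (key _ (by simpa using hao))
  let B : Sylow p H := Sylow.ofCard (Subgroup.zpowers ⟨b, hb⟩) (key _ (by simpa using hbo))
  obtain ⟨h, hh⟩ := exists_smul_eq H B A
  refine ⟨h, h.2, ?_⟩
  have hmem : h * ⟨b, hb⟩ * h⁻¹ ∈ A := by
    rw [← hh]
    exact Subgroup.smul_mem_pointwise_smul (⟨b, hb⟩ : H) (MulAut.conj h) _
      (Subgroup.mem_zpowers (⟨b, hb⟩ : H))
  obtain ⟨k, hk⟩ : ∃ k : ℤ, (⟨a, ha⟩ : H) ^ k = h * ⟨b, hb⟩ * h⁻¹ := hmem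
  exact ⟨k, by simpa using congrArg Subtype.val hk⟩

/-- On the support, a permutation commuting with the cycle is determined by the image of one point.
-/
theorem Equiv.Perm.IsCycle.mem_zpowers_of_commute {α : Type*} [Fintype α] [DecidableEq α]
    {σ u : Equiv.Perm α} (hσ : σ.IsCycle) (hu : Commute u σ) (hs : ∀ x, σ x = x → u x = x) :
    u ∈ Subgroup.zpowers σ := by
  obtain ⟨a, ha, hac⟩ := hσ
  have hua : σ (u a) ≠ u a := fun h ↦ ha <| u.injective <| by
    rw [← h]; exact congrArg (· a) hu.eq
  obtain ⟨i, hi⟩ := hac hua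
  refine ⟨i, Equiv.ext fun x ↦ ?_⟩
  change (σ ^ i) x = u x
  by_cases hx : σ x = x
  · rw [hs x hx]; exact Equiv.Perm.zpow_apply_eq_self_of_apply_eq_self hx i
  · obtain ⟨j, rfl⟩ := hac hx
    have h1 := congrArg (· a) (hu.zpow_right j).eq
    have h2 := congrArg (· a) (Commute.zpow_zpow_self σ i j).eq
    simp only [Equiv.Perm.mul_apply] at h1 h2
    rw [h1, h2, hi]

/-- The power maps `s ↦ s ^ i` and `s ↦ s ^ j` of a cyclic group commute, so `t * u` and `u * t`
conjugate `s` to the same element. -/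
theorem Commute.commutator_of_conj_eq_pow {G : Type*} [Group G] {s t u : G} {i j : ℤ}
    (ht : t * s * t⁻¹ = s ^ i) (hu : u * s * u⁻¹ = s ^ j) : Commute (t⁻¹ * u⁻¹ * t * u) s := by
  have h1 : (t * u) * s * (t * u)⁻¹ = s ^ (i * j) := by
    rw [zpow_mul, ← ht, conj_zpow, ← hu]; group
  have h2 : (u * t) * s * (u * t)⁻¹ = s ^ (i * j) := by
    rw [mul_comm, zpow_mul, ← hu, conj_zpow, ← ht]; group
  have h3 : (u * t)⁻¹ * s ^ (i * j) = s * (u * t)⁻¹ := by rw [← h2]; group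
  rw [commute_iff_eq, show t⁻¹ * u⁻¹ * t * u = (u * t)⁻¹ * (t * u) by group, mul_assoc,
    mul_inv_eq_iff_eq_mul.1 h1, ← mul_assoc, h3, mul_assoc]

open MulAction Equiv Equiv.Perm in
/-- Jordan: a transitive permutation group of degree `n` that contains an element of prime order
`p`, where `n < 2 * p` and `p + 3 ≤ n`, contains the alternating group. -/
theorem Equiv.Perm.alternatingGroup_le_of_isPretransitive_of_orderOf_prime
    {α : Type*} [Fintype α] [DecidableEq α] {G : Subgroup (Perm α)} [IsPretransitive G α]
    {p : ℕ} (hp : p.Prime) (hlow : Fintype.card α < 2 * p) (hhigh : p + 3 ≤ Fintype.card α)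
    {σ : Perm α} (hσG : σ ∈ G) (hσo : orderOf σ = p) : alternatingGroup α ≤ G := by
  have : Fact p.Prime := ⟨hp⟩
  have hσ : σ.IsCycle := isCycle_of_prime_order' (hσo ▸ hp) (hσo ▸ hlow)
  have hcard : σ.support.card = p := hσ.orderOf ▸ hσo
  let Δ : Set α := (σ.support : Set α)ᶜ
  have hΔ (x : α) : x ∈ Δ ↔ σ x = x := by simp [Δ]
  have hcardΔ : Δ.ncard + p = Fintype.card α := by
    have := Set.ncard_add_ncard_compl (σ.support : Set α)
    rw [Set.ncard_coe_finset, hcard, Nat.card_eq_fintype_card, add_comm] at this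
    exact this
  have := isPretransitive_of_isCycle_mem hσ hσG
  have hncard : Nat.card (SubMulAction.ofFixingSubgroup G Δ) = p := by
    rw [← hcard, ← Set.ncard_coe_finset]
    change (Δᶜ).ncard = _
    rw [compl_compl]
  have hprimΔ : IsPreprimitive (fixingSubgroup G Δ) (SubMulAction.ofFixingSubgroup G Δ) :=
    IsPreprimitive.of_prime_card (hncard ▸ hp)
  -- The fixator of `Δ` acts primitively on the complement of `Δ`, which contains more than half of
  -- the points.
  have hprim : IsPreprimitive G α := by
    apply IsPreprimitive.of_card_lt (f := SubMulAction.ofFixingSubgroup_equivariantMap G Δ)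
    rw [← Set.image_univ, Set.ncard_image_of_injective _
      SubMulAction.ofFixingSubgroup_equivariantMap_injective, Set.ncard_univ, hncard,
      Nat.card_eq_fintype_card]
    exact hlow
  have htrans : IsMultiplyPretransitive G α Δ.ncard := by
    obtain ⟨n, hn⟩ : ∃ n, Δ.ncard = n + 1 := ⟨Δ.ncard - 1, by omega⟩
    have : IsMultiplyPreprimitive G α (n + 2) :=
      hprim.isMultiplyPreprimitive hn (by rw [Nat.card_eq_fintype_card]; have := hp.two_le; omega)
        hprimΔ
    have : IsMultiplyPretransitive G α (n + 2) := IsMultiplyPreprimitive.isMultiplyPretransitive ..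
    exact isMultiplyPretransitive_of_le (n := n + 2) (by omega)
      (by rw [Nat.card_eq_fintype_card]; have := hp.two_le; omega)
  -- Frattini argument: `g ∈ G` inducing `s` on `Δ` exists by multiple transitivity; Sylow conjugacy
  -- in the fixator `H` of `Δ` corrects it to `h * g`, which normalizes `⟨σ⟩` and still induces `s`.
  have hext (s : Perm α) (hs : ∀ x ∈ Δ, s x ∈ Δ) (hs' : ∀ x ∈ Δ, s.symm x ∈ Δ) :
      ∃ t ∈ G, (∀ x ∈ Δ, t x = s x) ∧ ∃ i : ℤ, t * σ * t⁻¹ = σ ^ i := by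
    let e : Fin Δ.ncard ≃ Δ := (Finite.equivFinOfCardEq rfl).symm
    let x : Fin Δ.ncard ↪ α := e.toEmbedding.trans (Function.Embedding.subtype _)
    obtain ⟨g, hg⟩ := exists_smul_eq G x (x.trans s.toEmbedding)
    have hgs (d) (hd : d ∈ Δ) : (g : Perm α) d = s d := by
      have := DFunLike.congr_fun hg (e.symm ⟨d, hd⟩)
      simpa [x] using! this
    let H : Subgroup (Perm α) :=
      G ⊓ fixingSubgroup (Perm α) Δ
    have hmem (u : Perm α) : u ∈ H ↔ u ∈ G ∧ ∀ d ∈ Δ, u d = d := by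
      simp [H, mem_fixingSubgroup_iff]
    have hsinv (d) (hd : d ∈ Δ) : (g : Perm α)⁻¹ d ∈ Δ := by
      rw [inv_eq_iff_eq.2 (show d = (g : Perm α) (s.symm d) by simp [hgs _ (hs' d hd)])]
      exact hs' d hd
    obtain ⟨h, hh, k, hk⟩ := exists_conj_mem_zpowers_of_card_lt (p := p) hlow (H := H)
      (a := σ) (b := g * σ * g⁻¹)
      ((hmem _).2 ⟨hσG, fun d hd ↦ (hΔ d).1 hd⟩)
      ((hmem _).2 ⟨G.mul_mem (G.mul_mem g.2 hσG) (G.inv_mem g.2), fun d hd ↦ by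
        have h := (hΔ _).1 (hsinv d hd)
        rw [mul_apply, mul_apply]
        exact (congrArg (g : Perm α) h).trans (Equiv.apply_symm_apply (g : Perm α) d)⟩) hσo
      (by rw [← hσo]; exact orderOf_injective (MulAut.conj (g : Perm α)).toMonoidHom
            (MulAut.conj (g : Perm α)).injective σ)
    refine ⟨h * g, G.mul_mem ((hmem h).1 hh).1 g.2, fun d hd ↦ ?_, k, ?_⟩
    · rw [mul_apply, hgs d hd, ((hmem h).1 hh).2 _ (hs d hd)]
    · change σ ^ k = _ at hk
      rw [hk, mul_inv_rev, Subgroup.coe_inv]; simp only [mul_assoc]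
  obtain ⟨x, y, z, hx, hy, hz, hxy, hxz, hyz⟩ := (Set.two_lt_ncard_iff).1 (show 2 < Δ.ncard by omega)
  have hswap {a b : α} (ha : a ∈ Δ) (hb : b ∈ Δ) (d) (hd : d ∈ Δ) : swap a b d ∈ Δ := by
    rw [swap_apply_def]; split_ifs <;> assumption
  have hcomm {a b : α} (ha : a ∈ Δ) (hb : b ∈ Δ) : Commute (swap a b) σ := by
    rw [commute_iff_eq, mul_swap_eq_swap_mul, (hΔ a).1 ha, (hΔ b).1 hb]
  obtain ⟨t, htG, ht, i, hi⟩ := hext (swap x y) (hswap hx hy) (by simpa using hswap hx hy)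
  obtain ⟨u, huG, hu, j, hj⟩ := hext (swap y z) (hswap hy hz) (by simpa using hswap hy hz)
  have hinv {v s : Perm α} (hv : ∀ d ∈ Δ, v d = s d) (d) (hd : s d ∈ Δ) (hss : s (s d) = d) :
      v⁻¹ d = s d := by rw [inv_eq_iff_eq, hv _ hd, hss]
  let κ := t⁻¹ * u⁻¹ * t * u
  let τ := swap x y * swap y z * swap x y * swap y z
  have hτ : IsThreeCycle τ := by
    have : τ = swap z x * swap z y := by
      have h := swap_apply_apply (swap x y) y z
      rw [swap_apply_right, swap_apply_of_ne_of_ne hxz.symm hyz.symm, swap_inv] at h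
      simp only [τ]
      rw [← h, swap_comm x z, swap_comm y z]
    rw [this]
    exact isThreeCycle_swap_mul_swap_same hxz.symm hyz.symm hxy
  have hκG : κ ∈ G :=
    G.mul_mem (G.mul_mem (G.mul_mem (G.inv_mem htG) (G.inv_mem huG)) htG) huG
  have hκτ (d) (hd : d ∈ Δ) : κ d = τ d := by
    have h1 := hswap hy hz d hd
    have h2 := hswap hx hy _ h1
    have h3 := hswap hy hz _ h2
    have h4 := hswap hx hy _ h3
    simp only [κ, τ, mul_apply]
    rw [hu d hd, ht _ h1, hinv hu _ h3 (swap_apply_self ..), hinv ht _ h4 (swap_apply_self ..)]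
  -- `κ` and `τ` both centralize `σ` and agree on `Δ`, so they differ by a power of `σ`; this puts
  -- the 3-cycle `τ` in `G`.
  have hw : τ⁻¹ * κ ∈ Subgroup.zpowers σ := by
    refine hσ.mem_zpowers_of_commute ?_ fun d hd ↦ ?_
    · have hτσ : Commute τ σ :=
        (((hcomm hx hy).mul_left (hcomm hy hz)).mul_left (hcomm hx hy)).mul_left (hcomm hy hz)
      exact hτσ.inv_left.mul_left (Commute.commutator_of_conj_eq_pow hi hj)
    · rw [mul_apply, hκτ d ((hΔ d).2 hd), ← mul_apply, inv_mul_cancel, one_apply]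
  refine alternatingGroup_le_of_isPreprimitive_of_isThreeCycle_mem hprim hτ ?_
  have hwG : τ⁻¹ * κ ∈ G := (Subgroup.zpowers_le.2 hσG) hw
  simpa using G.mul_mem hκG (G.inv_mem hwG)

/-! ### Newton polygons over a valued field. -/

/-- A factor `X - C a` with `1 ≤ v a` scales the constant term by exactly `v a`, and the maximum
over all coefficients by at most `v a`. -/
theorem Valuation.coeff_prod_X_sub_C_le {K Γ₀ : Type*} [Field K]
    [LinearOrderedCommGroupWithZero Γ₀] (v : Valuation K Γ₀) (s : Multiset K)
    (hs : ∀ x ∈ s, 1 ≤ v x) (k : ℕ) :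
    v ((s.map fun x ↦ X - C x).prod.coeff k) ≤ v ((s.map fun x ↦ X - C x).prod.coeff 0) := by
  induction s using Multiset.induction_on generalizing k with
  | empty => simp only [Multiset.map_zero, Multiset.prod_zero, coeff_one]; split_ifs <;> simp
  | cons a s ih =>
    have hs' := fun x hx ↦ hs x (Multiset.mem_cons_of_mem hx)
    have ha := hs a (Multiset.mem_cons_self a s)
    rw [Multiset.map_cons, Multiset.prod_cons]
    set g := (s.map fun x ↦ X - C x).prod
    have h0 : v (((X - C a) * g).coeff 0) = v a * v (g.coeff 0) := by
      rw [mul_coeff_zero]; simp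
    rw [h0]
    cases k with
    | zero => exact h0.le
    | succ k =>
      rw [sub_mul, coeff_sub, coeff_X_mul, coeff_C_mul]
      refine (v.map_sub _ _).trans (max_le ((ih hs' k).trans (le_mul_of_one_le_left' ha)) ?_)
      rw [map_mul]
      exact mul_le_mul_right (ih hs' _) _

theorem Polynomial.exists_isRoot_valuation_lt_one {K Γ₀ : Type*} [Field K]
    [LinearOrderedCommGroupWithZero Γ₀] (v : Valuation K Γ₀) {f : K[X]} (hf : f.Splits) {m : ℕ}
    (h : v (f.coeff 0) < v (f.coeff m)) : ∃ x, f.IsRoot x ∧ v x < 1 := by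
  by_contra! hc
  have hf0 : f ≠ 0 := by rintro rfl; simp at h
  refine h.not_ge ?_
  rw [hf.eq_prod_roots, coeff_C_mul, coeff_C_mul, map_mul, map_mul]
  exact mul_le_mul_right
    (v.coeff_prod_X_sub_C_le f.roots (fun x hx ↦ hc x (isRoot_of_mem_roots hx)) m) _

/-- A Newton polygon whose first edge joins `(0, ord a₀)` to `(m, 0)` has a root of valuation
`ord a₀ / m`. -/
theorem Polynomial.exists_isRoot_valuation_pow_eq {K Γ₀ : Type*} [Field K]
    [LinearOrderedCommGroupWithZero Γ₀] (v : Valuation K Γ₀) {f : K[X]} (hf : f.Splits) {m : ℕ}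
    (h0 : f.coeff 0 ≠ 0) (h1 : v (f.coeff 0) < 1) (hlt : ∀ j < m, v (f.coeff j) ≤ v (f.coeff 0))
    (hm : v (f.coeff m) = 1) (hle : ∀ j, v (f.coeff j) ≤ 1) :
    ∃ x, f.IsRoot x ∧ v x ^ m = v (f.coeff 0) := by
  obtain ⟨x, hx, hx1⟩ := exists_isRoot_valuation_lt_one v hf (hm ▸ h1)
  refine ⟨x, hx, ?_⟩
  have hx0 : x ≠ 0 := by
    rintro rfl
    exact h0 (by rw [coeff_zero_eq_eval_zero]; exact hx)
  have hvx : 0 < v x := zero_lt_iff.2 (v.ne_zero_iff.2 hx0)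
  have hmd : m < f.natDegree + 1 := by
    refine Nat.lt_succ_of_le (le_natDegree_of_ne_zero fun h ↦ ?_)
    rw [h, map_zero] at hm
    exact zero_ne_one hm
  have hsum : ∑ j ∈ Finset.range (f.natDegree + 1), f.coeff j * x ^ j = 0 := by
    rw [← eval_eq_sum_range]; exact hx
  have hcontra {i : ℕ} (hi : i < f.natDegree + 1) (hne : f.coeff i ≠ 0)
      (h : ∀ j, j ≠ i → v (f.coeff j * x ^ j) < v (f.coeff i * x ^ i)) : False := by
    have := v.map_sum_eq_of_lt (f := fun j ↦ f.coeff j * x ^ j) (Finset.mem_range.2 hi)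
      (fun j hj ↦ h j (by simpa using (Finset.mem_sdiff.1 hj).2))
    rw [hsum, map_zero] at this
    exact mul_ne_zero hne (pow_ne_zero i hx0) (v.zero_iff.1 this.symm)
  have hhigh {j : ℕ} (hj : m < j) : v (f.coeff j * x ^ j) < v x ^ m := by
    rw [map_mul, map_pow]
    exact (mul_le_of_le_one_left' (hle j)).trans_lt (pow_lt_pow_right_of_lt_one₀ hvx hx1 hj)
  have hlow {j : ℕ} (hj : j < m) : v (f.coeff j * x ^ j) ≤ v (f.coeff 0) * v x ^ j := by
    rw [map_mul, map_pow]
    exact mul_le_mul_left (hlt j hj) _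
  have hv0 : 0 < v (f.coeff 0) := zero_lt_iff.2 (v.ne_zero_iff.2 h0)
  -- Without equality, one term of `∑ f.coeff j * x ^ j = 0` strictly dominates: the term `0` if `v
  -- x ^ m` is smaller, the term `m` if it is larger.
  rcases lt_trichotomy (v x ^ m) (v (f.coeff 0)) with h | h | h
  · refine (hcontra (i := 0) (Nat.succ_pos _) h0 fun j hj ↦ ?_).elim
    rw [pow_zero, mul_one]
    rcases lt_trichotomy j m with hjm | rfl | hjm
    · refine (hlow hjm).trans_lt (mul_lt_of_lt_one_right hv0 (pow_lt_one₀ zero_le hx1 hj))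
    · rwa [map_mul, hm, one_mul, map_pow]
    · exact (hhigh hjm).trans h
  · exact h
  · refine (hcontra hmd (fun h ↦ by simp [h] at hm) fun j hj ↦ ?_).elim
    rw [map_mul v (f.coeff m), hm, one_mul, map_pow]
    rcases hj.lt_or_gt with hjm | hjm
    · exact ((hlow hjm).trans (mul_le_of_le_one_right' (pow_le_one₀ zero_le hx1.le))).trans_lt h
    · exact hhigh hjm

/-! ### Ramification at `p` and the order of the Galois group. -/

open IsDedekindDomain WithZero in
theorem IsDedekindDomain.HeightOneSpectrum.valuation_rat_eq_exp {p : ℕ} (hp : p.Prime)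
    (v : HeightOneSpectrum ℤ) (hv : v.asIdeal = Ideal.span {(p : ℤ)}) {q : ℚ} (hq : q ≠ 0) :
    v.valuation ℚ q = exp (-padicValRat p q) := by
  have hint (z : ℤ) (hz : z ≠ 0) : v.valuation ℚ (z : ℚ) = exp (-(padicValInt p z : ℤ)) := by
    have h : v.valuation ℚ (z : ℚ) = v.intValuation z := v.valuation_of_algebraMap z
    rw [h, v.intValuation_eq_exp_neg_multiplicity hz, hv,
      padicValInt.of_ne_one_ne_zero hp.ne_one hz]
    congr 3
    exact multiplicity_eq_of_emultiplicity_eq Ideal.emultiplicity_eq_emultiplicity_span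
  have hden : (q.den : ℤ) ≠ 0 := by exact_mod_cast q.den_nz
  have := hint q.num (Rat.num_ne_zero.2 hq)
  have h2 := hint q.den hden
  rw [Int.cast_natCast] at h2
  conv_lhs => rw [← Rat.num_div_den q]
  rw [map_div₀, this, h2, padicValRat_def, ← exp_sub]
  congr 1
  simp [padicValInt]
  ring

-- Here `v` belongs to a prime of `𝓞 L` above `p` and `e` is its ramification index, which divides
-- the group order by `e * f * g = [L : ℚ]`.
open IsDedekindDomain WithZero NumberField in
theorem IsGalois.exists_valuation_rat_eq_exp (L : Type*) [Field L] [halg : Algebra ℚ L]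
    [FiniteDimensional ℚ L] [IsGalois ℚ L] {p : ℕ} (hp : p.Prime) :
    ∃ (e : ℕ) (v : Valuation L ℤᵐ⁰), e ∣ Nat.card Gal(L/ℚ) ∧
      ∀ q : ℚ, q ≠ 0 → v (algebraMap ℚ L q) = exp (-(e * padicValRat p q)) := by
  have : CharZero L := algebraRat.charZero L
  obtain rfl : halg = DivisionRing.toRatAlgebra := Subsingleton.elim _ _
  have : NumberField L := { }
  have hpz : Prime (p : ℤ) := Nat.prime_iff_prime_int.1 hp
  let P : Ideal ℤ := Ideal.span {(p : ℤ)}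
  have hP : P.IsPrime := (Ideal.span_singleton_prime hpz.ne_zero).2 hpz
  have hP0 : P ≠ ⊥ := by simpa [P] using hp.ne_zero
  let v : HeightOneSpectrum ℤ := ⟨P, hP, hP0⟩
  obtain ⟨⟨Q, hQ, hQP⟩⟩ := (inferInstance : Nonempty (P.primesOver (𝓞 L)))
  have hQ0 : Q ≠ ⊥ := Ideal.ne_bot_of_liesOver_of_ne_bot hP0 Q
  let w : HeightOneSpectrum (𝓞 L) := ⟨Q, hQ, hQ0⟩
  have : w.asIdeal.LiesOver v.asIdeal := hQP
  refine ⟨v.asIdeal.ramificationIdx' w.asIdeal, w.valuation L, ?_, fun q hq ↦ ?_⟩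
  · have := IsGaloisGroup.of_isFractionRing Gal(L/ℚ) ℤ (𝓞 L) ℚ L
    rw [← Ideal.ncard_primesOver_mul_ramificationIdxIn_mul_inertiaDegIn P (𝓞 L) Gal(L/ℚ),
      Ideal.ramificationIdxIn_eq_ramificationIdx P Q Gal(L/ℚ)]
    change P.ramificationIdx' Q ∣ _
    rw [Ideal.ramificationIdx'_eq_ramificationIdx P Q hP0]
    exact (dvd_mul_right _ _).mul_left _
  · rw [← HeightOneSpectrum.valuation_liesOver L v w, v.valuation_rat_eq_exp hp rfl hq, ← exp_nsmul]
    congr 1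
    simp

theorem ordAt_nonneg_iff {p : ℕ} {q : ℚ} (hq : q ≠ 0) : 0 ≤ ordAt p q ↔ 0 ≤ padicValRat p q := by
  rw [ordAt, if_neg hq, ← WithTop.coe_zero, WithTop.coe_le_coe]

theorem ordAt_eq_coe_iff {p : ℕ} {q : ℚ} {m : ℤ} :
    ordAt p q = m ↔ q ≠ 0 ∧ padicValRat p q = m := by
  by_cases hq : q = 0
  · simp [ordAt, hq]
  · rw [ordAt, if_neg hq, WithTop.coe_inj]
    simp [hq]

/-- By Lucas, the binomial coefficient is `1` modulo `p`, since `n / p = 1`. -/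
theorem Nat.Prime.not_dvd_choose_self {p n : ℕ} (hp : p.Prime) (hn : p ≤ n) (hn' : n < 2 * p) :
    ¬ p ∣ n.choose p := by
  have : Fact p.Prime := ⟨hp⟩
  have h := Choose.choose_modEq_choose_mod_mul_choose_div_nat (n := n) (k := p) (p := p)
  rw [Nat.mod_self, Nat.div_self hp.pos, Nat.div_eq_of_lt_le (by omega) (by omega : n < (1 + 1) * p),
    Nat.choose_zero_right, Nat.choose_self, mul_one] at h
  rw [h.dvd_iff dvd_rfl]
  exact hp.not_dvd_one

open WithZero in
theorem Polynomial.IsSplittingField.prime_dvd_card_of_ordAt {f : ℚ[X]} (L : Type*) [Field L]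
    [Algebra ℚ L] [IsSplittingField ℚ L f] {p : ℕ} (hp : p.Prime)
    (h0 : ordAt p (f.coeff 0) = 1) (hlt : ∀ j < p, 1 ≤ ordAt p (f.coeff j))
    (hpp : ordAt p (f.coeff p) = 0) (hle : ∀ j, 0 ≤ ordAt p (f.coeff j)) :
    p ∣ Nat.card Gal(L/ℚ) := by
  have hp0 := (ordAt_eq_coe_iff (m := 1)).1 h0
  have hp1 := (ordAt_eq_coe_iff (m := 0)).1 hpp
  have := IsSplittingField.finiteDimensional L f
  have : IsGalois ℚ L :=
    have := Normal.of_isSplittingField (E := L) f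
    ⟨⟩
  obtain ⟨e, v, he, hv⟩ := IsGalois.exists_valuation_rat_eq_exp L hp
  have he0 : e ≠ 0 := by rintro rfl; exact Nat.card_pos.ne' (zero_dvd_iff.1 he)
  have hbound (m : ℤ) (q : ℚ) (hq : (m : WithTop ℤ) ≤ ordAt p q) :
      v (algebraMap ℚ L q) ≤ exp (-(e * m)) := by
    by_cases h : q = 0
    · simp [h]
    · rw [ordAt, if_neg h, WithTop.coe_le_coe] at hq
      rw [hv q h, exp_le_exp, neg_le_neg_iff]
      gcongr
  have hv0 : v ((f.map (algebraMap ℚ L)).coeff 0) = exp (-(e : ℤ)) := by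
    rw [coeff_map, hv _ hp0.1, hp0.2, mul_one]
  obtain ⟨x, -, hx⟩ := exists_isRoot_valuation_pow_eq v (IsSplittingField.splits L f) (m := p)
    (by rw [coeff_map]; exact (_root_.map_ne_zero _).2 hp0.1)
    (by rw [hv0, ← exp_zero, exp_lt_exp]; omega)
    (fun j hj ↦ by
      rw [hv0, coeff_map]
      simpa using hbound 1 _ (hlt j hj))
    (by rw [coeff_map, hv _ hp1.1, hp1.2, mul_zero, neg_zero, exp_zero])
    (fun j ↦ by
      rw [coeff_map]
      simpa using hbound 0 _ (hle j))
  rw [hv0] at hx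
  refine Dvd.dvd.trans ?_ he
  have hlog := congrArg log hx
  rw [log_pow, log_exp, nsmul_eq_mul] at hlog
  -- The root satisfies `v x ^ p = exp (-e)` in a value group isomorphic to `ℤ`.
  have : (p : ℤ) ∣ e := ⟨-log (v x), by linarith⟩
  exact_mod_cast this

/-! ### The Galois group of `f`. -/

theorem lemma3p1 (n : ℕ) (c : ℕ → ℚ) (f : ℚ[X])
    (hf : f = ∑ j ∈ Finset.range (n + 1), C ((n.choose j : ℚ) * c j) * X ^ j)
    (hdeg : f.natDegree = n) (hirr : Irreducible f)
    (p : ℕ) (hp : p.Prime)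
    (hlow : (n : ℚ) / 2 < (p : ℚ)) (hhigh : (p : ℚ) < (n : ℚ) - 2)
    (hint : ∀ j : ℕ, j ≤ n → 0 ≤ ordAt p (c j))
    (hone : ∀ j : ℕ, j ≤ n - p → ordAt p (c j) = 1)
    (hzero : ordAt p (c p) = 0) :
    GaloisGroupContainsAlternating f := by
  have hlow' : n < 2 * p := by
    have : (n : ℚ) < 2 * p := by linarith
    exact_mod_cast this
  have hhigh' : p + 3 ≤ n := by
    have : (p : ℚ) + 2 < n := by linarith
    exact_mod_cast this
  have : Fact p.Prime := ⟨hp⟩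
  have hcoeff (j : ℕ) : f.coeff j = n.choose j * c j := by
    rw [hf, finsetSum_coeff]
    simp only [coeff_C_mul, coeff_X_pow, mul_ite, mul_one, mul_zero]
    rw [Finset.sum_ite_eq]
    split_ifs with h
    · rfl
    · rw [Nat.choose_eq_zero_of_lt (by simpa using h)]; simp
  have hord (j : ℕ) : ordAt p (f.coeff j) = ordAt p (n.choose j) + ordAt p (c j) := by
    rw [hcoeff]
    by_cases h1 : (n.choose j : ℚ) = 0
    · simp [ordAt, h1]
    by_cases h2 : c j = 0
    · simp [ordAt, h2]
    simp only [ordAt, h1, h2, mul_ne_zero h1 h2, if_false]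
    rw [padicValRat.mul h1 h2, WithTop.coe_add]
  have hnat (m : ℕ) : 0 ≤ ordAt p m := by
    rcases eq_or_ne (m : ℚ) 0 with h | h
    · simp [ordAt, h]
    · rw [ordAt_nonneg_iff h, padicValRat.of_nat]; positivity
  have hunit {m : ℕ} (hm : ¬ p ∣ m) : ordAt p m = 0 := by
    refine ordAt_eq_coe_iff.2 ⟨?_, ?_⟩
    · rw [Nat.cast_ne_zero]; rintro rfl; exact hm (dvd_zero p)
    · rw [padicValRat.of_nat, padicValNat.eq_zero_of_not_dvd hm]; rfl
  have hdvd {m : ℕ} (hm : p ∣ m) : 1 ≤ ordAt p m := by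
    rcases eq_or_ne m 0 with rfl | h
    · simp [ordAt]
    · have h1 := one_le_padicValNat_of_dvd h hm
      rw [ordAt, if_neg (Nat.cast_ne_zero.2 h), padicValRat.of_nat]
      exact_mod_cast h1
  have hge (j : ℕ) : 0 ≤ ordAt p (f.coeff j) := by
    rcases le_or_gt j n with hj | hj
    · rw [hord]; exact add_nonneg (hnat _) (hint j hj)
    · rw [hcoeff, Nat.choose_eq_zero_of_lt hj]; simp [ordAt]
  have hcard : p ∣ Nat.card f.Gal := by
    refine @IsSplittingField.prime_dvd_card_of_ordAt f f.SplittingField _ _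
      (IsSplittingField.splittingField f) p hp ?_ (fun j hj ↦ ?_) ?_ hge
    · rw [hord, hone 0 (Nat.zero_le _), hunit (by simpa using hp.ne_one), zero_add]
    · rw [hord]
      -- Beyond `n - p`, `c j` may be a unit; but `j` and `n - j` are then both less than `p ≤ n`,
      -- so the binomial coefficient supplies the factor `p`.
      rcases le_or_gt j (n - p) with h | h
      · rw [hone j h]; exact le_add_of_nonneg_left (hnat _)
      · exact le_add_of_le_of_nonneg (hdvd (hp.dvd_choose hj (by omega) (by omega)))
          (hint j (by omega))
    · rw [hord, hzero, add_zero, hunit (hp.not_dvd_choose_self (by omega) hlow')]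
  unfold GaloisGroupContainsAlternating
  let : DecidableEq (f.rootSet ℂ) := Classical.decEq _
  have : Fact ((f.map (algebraMap ℚ ℂ)).Splits) := Polynomial.Gal.splits_ℚ_ℂ
  have hroots : Fintype.card (f.rootSet ℂ) = n := by
    rw [card_rootSet_eq_natDegree hirr.separable this.out, hdeg]
  have htrans : MulAction.IsPretransitive (Gal.galActionHom f ℂ).range (f.rootSet ℂ) := by
    have := Gal.galAction_isPretransitive f ℂ hirr
    refine ⟨fun x y ↦ ?_⟩
    obtain ⟨g, hg⟩ := MulAction.exists_smul_eq f.Gal x y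
    exact ⟨⟨_, g, rfl⟩, hg⟩
  obtain ⟨g, hg⟩ := exists_prime_orderOf_dvd_card' p hcard
  refine Equiv.Perm.alternatingGroup_le_of_isPretransitive_of_orderOf_prime hp (by omega)
    (by omega) (σ := Gal.galActionHom f ℂ g) ⟨g, rfl⟩ ?_
  rw [← hg]
  exact orderOf_injective _ (Gal.galActionHom_injective f ℂ) g
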